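/- Theorem. For every integer $d \ge 1$ there is a constant $c_d > 0$, depending only on $d$, such that the following holds. For every $N \ge 1$, all points $x_1,\dots,x_N \in [0,1]^d$ (repetitions allowed) and every Lipschitz function $f:[0,1]^d \to \mathbb{R}$, $$\left|\int_{[0,1]^d} f(x)\,dx - \frac1N\sum_{k=1}^N f(x_k)\right| \le c_d \cdot \|\nabla f\|_{L^\infty([0,1]^d)}^{\frac{d-1}{d}} \cdot \|\nabla f\|_{L^1([0,1]^d)}^{\frac1d} \cdot N^{1/d} \cdot W_\infty\left(dx, \frac1N\sum_{k=1}^N \delta_{x_k}\right)^2.$$ Here $\nabla f$ is the gradient of $f$, which exists almost everywhere on $[0,1]^d$; the norms are those of $|\nabla f|$, with $|\cdot|$ the Euclidean norm; $dx$ is Lebesgue measure on $[0,1]^d$; and $W_\infty(\mu,\nu) = \inf_\pi \operatorname{ess\,sup}_{(x,y)\sim\pi} |x-y|$ is the $\infty$-Wasserstein distance, the infimum being over all measures $\pi$ whose first and second marginals are $\mu$ and $\nu$. For $d=1$ the factor $\|\nabla f\|_{L^\infty}^{0}$ is read as $1$. -/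

import Mathlib

open MeasureTheory
open scoped ENNReal NNReal

/-- The unit cube `[0,1]^d` in `d`-dimensional Euclidean space. -/
def unitCube (d : ℕ) : Set (EuclideanSpace ℝ (Fin d)) :=
  {x | ∀ i, x i ∈ Set.Icc (0 : ℝ) 1}

/-- Lebesgue measure `dx` on the unit cube, as a measure on Euclidean space. -/
noncomputable def cubeMeasure (d : ℕ) : Measure (EuclideanSpace ℝ (Fin d)) :=
  volume.restrict (unitCube d)

/-- The empirical measure `(1/N) ∑ δ_{x_k}` of the points `x_1, …, x_N`. -/
noncomputable def empiricalMeasure {X : Type*} [MeasurableSpace X] {N : ℕ} (x : Fin N → X) :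
    Measure X :=
  (N : ℝ≥0∞)⁻¹ • ∑ k, Measure.dirac (x k)

/-- `π` is a transport plan (coupling) between `μ` and `ν`: its marginals are `μ` and `ν`. -/
def IsTransportPlan {X : Type*} [MeasurableSpace X] (μ ν : Measure X) (π : Measure (X × X)) :
    Prop :=
  π.fst = μ ∧ π.snd = ν

/-- The `∞`-Wasserstein distance: the infimum, over all transport plans `π` between `μ` and `ν`,
of the `π`-essential supremum of the distance `(x, y) ↦ dist x y`. -/
noncomputable def wassersteinInfty {X : Type*} [MeasurableSpace X] [PseudoEMetricSpace X]
    (μ ν : Measure X) : ℝ≥0∞ :=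
  ⨅ (π : Measure (X × X)) (_ : IsTransportPlan μ ν π), essSup (fun p => edist p.1 p.2) π

/-! ### Increments of Lipschitz functions on convex bodies. -/

section Oscillation

variable {E : Type*} [NormedAddCommGroup E] [NormedSpace ℝ E]

/-! Fix a plan `π` that moves mass by at most `R`. The error is the `π`-integral of `g p.1 - g p.2`,
so increments of `g` at scale `R` have to be bounded. If the increment between two points is `M`, an
increment of at least `M / 2` persists on a whole bundle of parallel segments of width about `M /
L`, where `L` is the Lipschitz constant. Integrating the derivative over the bundle gives `M ^ d ≲ L
^ (d - 1) * ∫ |∇g|`, the integral being over a ball of radius `R` about the sample point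
(`LipschitzWith.abs_sub_pow_mul_measure_le`, `LipschitzWith.enorm_sub_le_localVariation`).

In the average over the samples, Jensen takes the root `1 / d` outside. By Fubini each `z` is then
counted with the empirical mass of a ball of radius `R`, which is at most the Lebesgue mass of a
ball of radius `2 * R`, hence `≲ R ^ d`. The error is thus `≲ L ^ ((d - 1) / d) * ‖∇g‖₁ ^ (1 / d) *
R`. Finally, the mass `1 / N` of one sample comes from a ball of radius `R`, so `1 ≲ N ^ (1 / d) *
R` (`IsTransportPlan.one_le_radius`); this supplies the second factor `R`. The infimum over plans
concludes. -/

/-- The increment of a Lipschitz function along a segment is bounded by the integral of its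
derivative, provided the function is differentiable at almost every point of the segment. -/
theorem LipschitzWith.enorm_sub_le_lintegral_fderiv {g : E → ℝ} {K : ℝ≥0} (hg : LipschitzWith K g)
    (p v : E) (hd : ∀ᵐ t : ℝ, DifferentiableAt ℝ g (p + t • v)) :
    ‖g (p + v) - g p‖ₑ ≤ ‖v‖ₑ * ∫⁻ t in Set.Icc (0 : ℝ) 1, ‖fderiv ℝ g (p + t • v)‖ₑ := by
  set h : ℝ → ℝ := fun t => g (p + t • v) with hh
  have hlip : LipschitzWith (K * ‖v‖₊) h := by
    refine hg.comp (LipschitzWith.of_dist_le_mul fun a b => ?_)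
    rw [dist_add_left, dist_eq_norm, ← sub_smul, norm_smul, dist_eq_norm, mul_comm, coe_nnnorm]
  have hftc := (hlip.lipschitzOnWith (s := Set.uIcc 0 1)).absolutelyContinuousOnInterval
    |>.integral_deriv_eq_sub
  have h1 : g (p + v) - g p = ∫ t in (0 : ℝ)..1, deriv h t := by
    rw [hftc]; simp [hh]
  rw [h1, intervalIntegral.integral_of_le zero_le_one, ← lintegral_const_mul' _ _ enorm_ne_top]
  refine (enorm_integral_le_lintegral_enorm _).trans ?_
  rw [Measure.restrict_congr_set Ioc_ae_eq_Icc]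
  refine lintegral_mono_ae (ae_restrict_of_ae ?_)
  filter_upwards [hd] with t ht
  have hderiv : HasDerivAt h (fderiv ℝ g (p + t • v) v) t := by
    have h2 : HasDerivAt (fun t : ℝ => p + t • v) v t := by
      simpa using ((hasDerivAt_id t).smul_const v).const_add p
    exact ht.hasFDerivAt.comp_hasDerivAt t h2
  rw [hderiv.deriv, mul_comm]
  exact ContinuousLinearMap.le_opENorm _ _

/-- The point equals `(1 - s) • ((1 - t) • x + t • y) + s • w`. Contracting towards `w ∈ Q`, rather
than translating, keeps the shifted segment inside `Q`. -/
theorem Convex.shift_mem {Q : Set E} (hQ : Convex ℝ Q) {x y w : E} (hx : x ∈ Q) (hy : y ∈ Q)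
    (hw : w ∈ Q) {s t : ℝ} (hs0 : 0 ≤ s) (hs1 : s ≤ 1) (ht : t ∈ Set.Icc (0 : ℝ) 1) :
    (1 - s) • x + s • w + t • ((1 - s) • (y - x)) ∈ Q := by
  have h1 : (1 - t) • x + t • y ∈ Q := hQ hx hy (by linarith [ht.2]) ht.1 (by ring)
  have h2 := hQ h1 hw (sub_nonneg.2 hs1) hs0 (by ring)
  convert h2 using 1
  module

/-- Contracting towards `w` by the factor `1 - s` moves each endpoint by at most `s * D`, which
costs `L * (s * D)` per endpoint. -/
theorem Convex.abs_sub_le_abs_shift_sub_add {g : E → ℝ} {Q : Set E} {L : ℝ} (hL0 : 0 ≤ L)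
    (hL : ∀ a ∈ Q, ∀ b ∈ Q, |g a - g b| ≤ L * dist a b) (hQ : Convex ℝ Q) {D : ℝ}
    (hD : ∀ a ∈ Q, ∀ b ∈ Q, dist a b ≤ D) {x y w : E} (hx : x ∈ Q) (hy : y ∈ Q) (hw : w ∈ Q)
    {s : ℝ} (hs0 : 0 ≤ s) (hs1 : s ≤ 1) :
    |g y - g x| ≤ |g ((1 - s) • y + s • w) - g ((1 - s) • x + s • w)| + 2 * (L * (s * D)) := by
  have key : ∀ a ∈ Q, |g a - g ((1 - s) • a + s • w)| ≤ L * (s * D) := by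
    intro a ha
    refine (hL a ha _ (hQ ha hw (sub_nonneg.2 hs1) hs0 (by ring))).trans ?_
    gcongr
    have : a - ((1 - s) • a + s • w) = s • (a - w) := by module
    rw [dist_eq_norm, this, norm_smul, Real.norm_of_nonneg hs0, ← dist_eq_norm]
    gcongr
    exact hD a ha w hw
  have h1 := key x hx
  have h2 := key y hy
  rw [abs_le] at h1 h2
  have h3 := neg_abs_le (g ((1 - s) • y + s • w) - g ((1 - s) • x + s • w))
  have h4 := le_abs_self (g ((1 - s) • y + s • w) - g ((1 - s) • x + s • w))
  rw [abs_le]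
  constructor <;> linarith

variable [FiniteDimensional ℝ E] [MeasurableSpace E] [BorelSpace E]
  (μ : Measure E) [μ.IsAddHaarMeasure]

theorem lintegral_comp_add_smul (c : E) {s : ℝ} (hs : 0 < s) {F : E → ℝ≥0∞} (hF : Measurable F) :
    ENNReal.ofReal (s ^ Module.finrank ℝ E) * ∫⁻ w, F (c + s • w) ∂μ = ∫⁻ z, F z ∂μ := by
  have h1 : ∫⁻ w, F (c + s • w) ∂μ = ∫⁻ z, F (c + z) ∂(Measure.map (s • ·) μ) := by
    rw [lintegral_map (by fun_prop) (by fun_prop)]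
  rw [h1, Measure.map_addHaar_smul μ hs.ne', lintegral_smul_measure, lintegral_add_left_eq_self,
    smul_eq_mul, ← mul_assoc, ← ENNReal.ofReal_mul (by positivity), abs_of_pos (by positivity),
    mul_inv_cancel₀ (by positivity), ENNReal.ofReal_one, one_mul]

/-- A property that holds almost everywhere holds at almost every point of almost every
line in a given direction. -/
theorem ae_ae_line {p : E → Prop} (hp : MeasurableSet {z | p z}) (h : ∀ᵐ z ∂μ, p z) (c v : E)
    {s : ℝ} (hs : 0 < s) : ∀ᵐ w ∂μ, ∀ᵐ t : ℝ, p (c + s • w + t • v) := by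
  rw [Measure.ae_ae_comm (p := fun w (t : ℝ) => p (c + s • w + t • v))
    (hp.preimage (by fun_prop : Measurable fun q : E × ℝ => c + s • q.1 + q.2 • v))]
  -- For fixed `t` the map `w ↦ c + t • v + s • w` pulls null sets back to null sets.
  refine Filter.Eventually.of_forall fun t => ?_
  have h1 := lintegral_comp_add_smul μ (c + t • v) hs
    (F := {z | p z}ᶜ.indicator 1) (measurable_one.indicator hp.compl)
  rw [lintegral_indicator_one hp.compl] at h1
  have h2 : μ {z | p z}ᶜ = 0 := h
  rw [h2, mul_eq_zero, ENNReal.ofReal_eq_zero] at h1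
  have h3 := h1.resolve_left (not_le.2 (by positivity))
  have hm : Measurable fun w => {z | p z}ᶜ.indicator (1 : E → ℝ≥0∞) (c + t • v + s • w) :=
    (measurable_one.indicator hp.compl).comp (by fun_prop)
  rw [lintegral_eq_zero_iff hm] at h3
  filter_upwards [h3] with w hw
  by_contra hcon
  have : c + t • v + s • w ∈ {z | p z}ᶜ := by
    simpa [add_right_comm] using hcon
  simp [this] at hw

theorem LipschitzWith.ae_ae_line_differentiableAt {g : E → ℝ} {K : ℝ≥0} (hg : LipschitzWith K g)
    (c v : E) {s : ℝ} (hs : 0 < s) :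
    ∀ᵐ w ∂μ, ∀ᵐ t : ℝ, DifferentiableAt ℝ g (c + s • w + t • v) :=
  ae_ae_line μ (measurableSet_of_differentiableAt ℝ g) hg.ae_differentiableAt c v hs

/-- Integrating increments of `g` over small parallel shifts of the segment `[x, y]` inside a
convex set `Q` is controlled by the integral of the derivative over `Q`. -/
theorem LipschitzWith.lintegral_shift_le {g : E → ℝ} {K : ℝ≥0} (hg : LipschitzWith K g)
    {Q : Set E} (hQ : Convex ℝ Q) (hQm : MeasurableSet Q) {D : ℝ}
    (hD : ∀ a ∈ Q, ∀ b ∈ Q, dist a b ≤ D) {x y : E} (hx : x ∈ Q) (hy : y ∈ Q)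
    {s : ℝ} (hs0 : 0 < s) (hs1 : s < 1) :
    ENNReal.ofReal (s ^ Module.finrank ℝ E) *
        ∫⁻ w in Q, ‖g ((1 - s) • y + s • w) - g ((1 - s) • x + s • w)‖ₑ ∂μ ≤
      ENNReal.ofReal (s * D) * ∫⁻ z in Q, ‖fderiv ℝ g z‖ₑ ∂μ := by
  rcases eq_or_ne x y with rfl | hxy
  · simp
  set v : E := (1 - s) • (y - x) with hv
  have hv0 : v ≠ 0 := smul_ne_zero (by linarith) (sub_ne_zero.2 hxy.symm)
  have hvn : 0 < ‖v‖ := norm_pos_iff.2 hv0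
  set c : E := (1 - s) • x with hc
  set G : E → ℝ≥0∞ := fun z => ‖fderiv ℝ g z‖ₑ with hG
  have hGm : Measurable G := (measurable_fderiv ℝ g).enorm
  -- In the variable `z = c + t • v + s • w`, `S` records that `t ∈ [0, 1]` and that the parameter
  -- `w` recovered from `(t, z)` lies in `Q`.
  set S : Set (ℝ × E) := {q | q.1 ∈ Set.Icc (0 : ℝ) 1 ∧ s⁻¹ • (q.2 - (c + q.1 • v)) ∈ Q} with hS
  have hSm : MeasurableSet S :=
    (measurableSet_Icc.preimage measurable_fst).inter
      (hQm.preimage (by fun_prop : Measurable fun q : ℝ × E => s⁻¹ • (q.2 - (c + q.1 • v))))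
  set F : ℝ × E → ℝ≥0∞ := S.indicator fun q => G q.2 with hF
  have hFm : Measurable F := (hGm.comp measurable_snd).indicator hSm
  have hstep : ∫⁻ w in Q, ‖g ((1 - s) • y + s • w) - g ((1 - s) • x + s • w)‖ₑ ∂μ ≤
      ‖v‖ₑ * ∫⁻ t, ∫⁻ w, F (t, c + t • v + s • w) ∂μ := by
    rw [lintegral_lintegral_swap (by fun_prop), ← lintegral_const_mul' _ _ enorm_ne_top,
      ← lintegral_indicator hQm]
    refine lintegral_mono_ae ?_
    filter_upwards [hg.ae_ae_line_differentiableAt μ c v hs0] with w hw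
    by_cases hwQ : w ∈ Q
    · rw [Set.indicator_of_mem hwQ]
      have h1 := hg.enorm_sub_le_lintegral_fderiv (c + s • w) v hw
      have h2 : c + s • w + v = (1 - s) • y + s • w := by rw [hc, hv]; module
      rw [h2] at h1
      refine h1.trans ?_
      refine mul_le_mul_right ?_ _
      rw [← lintegral_indicator measurableSet_Icc]
      refine lintegral_mono fun t => ?_
      by_cases ht : t ∈ Set.Icc (0 : ℝ) 1
      · rw [Set.indicator_of_mem ht, hF, Set.indicator_of_mem, add_right_comm]
        refine ⟨ht, ?_⟩
        simpa [smul_smul, hs0.ne'] using hwQ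
      · simp [Set.indicator_of_notMem ht]
    · simp [Set.indicator_of_notMem hwQ]
  -- Two times `a`, `b` reaching the same `z` have parameters `w` at distance `|a - b| * ‖v‖ / s`,
  -- which is at most `D`. Points `z` outside `Q` are never reached.
  have hslice : ∀ z, ∫⁻ t, F (t, z) ≤ Q.indicator G z * ENNReal.ofReal (s * D / ‖v‖) := by
    intro z
    have h1 : ∀ t, F (t, z) = {t | (t, z) ∈ S}.indicator (fun _ => G z) t := fun t => rfl
    simp_rw [h1]
    have hm : MeasurableSet {t | (t, z) ∈ S} := hSm.preimage measurable_prodMk_right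
    rw [lintegral_indicator hm, lintegral_const,
      Measure.restrict_apply MeasurableSet.univ, Set.univ_inter]
    by_cases hz : z ∈ Q
    · rw [Set.indicator_of_mem hz]
      gcongr
      refine (Real.volume_le_diam _).trans (Metric.ediam_le fun a ha b hb => ?_)
      rw [edist_dist]
      refine ENNReal.ofReal_le_ofReal ?_
      rw [le_div_iff₀ hvn]
      have h3 := hD _ ha.2 _ hb.2
      have h4 : s⁻¹ • (z - (c + a • v)) - s⁻¹ • (z - (c + b • v)) = s⁻¹ • ((b - a) • v) := by
        module
      rw [dist_eq_norm, h4, norm_smul, norm_smul, Real.norm_eq_abs, abs_inv, abs_of_pos hs0,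
        inv_mul_le_iff₀ hs0] at h3
      rwa [dist_comm, dist_eq_norm]
    · have : {t | (t, z) ∈ S} = ∅ := by
        refine Set.eq_empty_iff_forall_notMem.2 fun t ht => hz ?_
        have h5 := hQ.shift_mem hx hy ht.2 hs0.le hs1.le ht.1
        convert h5 using 1
        simp only
        rw [smul_smul, mul_inv_cancel₀ hs0.ne', one_smul, ← hc, ← hv]
        abel
      simp [this]
  calc ENNReal.ofReal (s ^ Module.finrank ℝ E) *
        ∫⁻ w in Q, ‖g ((1 - s) • y + s • w) - g ((1 - s) • x + s • w)‖ₑ ∂μ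
      ≤ ENNReal.ofReal (s ^ Module.finrank ℝ E) *
          (‖v‖ₑ * ∫⁻ t, ∫⁻ w, F (t, c + t • v + s • w) ∂μ) := by gcongr
    _ = ‖v‖ₑ * ∫⁻ t, ∫⁻ z, F (t, z) ∂μ := by
        rw [mul_left_comm, ← lintegral_const_mul' _ _ ENNReal.ofReal_ne_top]
        congr 1
        refine lintegral_congr fun t => ?_
        exact lintegral_comp_add_smul μ (c + t • v) hs0 (F := fun z => F (t, z))
          (hFm.comp measurable_prodMk_left)
    _ = ‖v‖ₑ * ∫⁻ z, (∫⁻ t : ℝ, F (t, z)) ∂μ := by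
        rw [lintegral_lintegral_swap (f := fun t z => F (t, z)) hFm.aemeasurable]
    _ ≤ ‖v‖ₑ * ∫⁻ z, Q.indicator G z * ENNReal.ofReal (s * D / ‖v‖) ∂μ := by
        gcongr with z
        exact hslice z
    _ = ENNReal.ofReal (s * D) * ∫⁻ z in Q, ‖fderiv ℝ g z‖ₑ ∂μ := by
        rw [lintegral_mul_const' _ _ ENNReal.ofReal_ne_top, lintegral_indicator hQm, mul_comm
          (∫⁻ z in Q, G z ∂μ), ← mul_assoc, ← ofReal_norm,
          ← ENNReal.ofReal_mul (norm_nonneg _), mul_div_cancel₀ _ hvn.ne']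

/-- On a convex body, the essential supremum of the derivative is a Lipschitz constant. -/
theorem LipschitzWith.abs_sub_le_of_ae_fderiv_le {g : E → ℝ} {K : ℝ≥0} (hg : LipschitzWith K g)
    {Q : Set E} (hQ : Convex ℝ Q) (hQm : MeasurableSet Q) (hQ0 : μ Q ≠ 0) {D : ℝ}
    (hD : ∀ a ∈ Q, ∀ b ∈ Q, dist a b ≤ D) {L : ℝ≥0}
    (hL : ∀ᵐ z ∂μ.restrict Q, ‖fderiv ℝ g z‖ₑ ≤ L) {x y : E} (hx : x ∈ Q) (hy : y ∈ Q) :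
    |g y - g x| ≤ L * dist y x := by
  -- The segment `[x, y]` itself may lie in the exceptional null set, so it is replaced by a shift
  -- for a generic `w ∈ Q`; afterwards `s → 0`.
  have hmain : ∀ s ∈ Set.Ioo (0 : ℝ) 1, |g y - g x| ≤ L * dist y x + 2 * (K * (s * D)) := by
    rintro s ⟨hs0, hs1⟩
    have hpm : MeasurableSet {z | z ∈ Q → ‖fderiv ℝ g z‖ₑ ≤ L} := by
      have : {z | z ∈ Q → ‖fderiv ℝ g z‖ₑ ≤ L} = Qᶜ ∪ {z | ‖fderiv ℝ g z‖ₑ ≤ L} := by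
        ext z; simp [imp_iff_not_or]
      rw [this]
      exact hQm.compl.union (measurableSet_le (measurable_fderiv ℝ g).enorm measurable_const)
    have h1 := ae_ae_line μ hpm ((ae_restrict_iff' hQm).1 hL) ((1 - s) • x)
      ((1 - s) • (y - x)) hs0
    have h2 := hg.ae_ae_line_differentiableAt μ ((1 - s) • x) ((1 - s) • (y - x)) hs0
    obtain ⟨w, hwQ, hw1, hw2⟩ : ∃ w ∈ Q, (∀ᵐ t : ℝ, _) ∧ ∀ᵐ t : ℝ, _ := by
      have h3 : ∃ᵐ w ∂μ, w ∈ Q := frequently_ae_mem_iff.2 hQ0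
      exact (h3.and_eventually (h1.and h2)).exists
    have h4 := hg.enorm_sub_le_lintegral_fderiv _ _ hw2
    have h5 : (1 - s) • x + s • w + (1 - s) • (y - x) = (1 - s) • y + s • w := by module
    rw [h5] at h4
    have h6 : ∫⁻ t in Set.Icc (0 : ℝ) 1,
        ‖fderiv ℝ g ((1 - s) • x + s • w + t • ((1 - s) • (y - x)))‖ₑ ≤ L := by
      calc _ ≤ ∫⁻ t in Set.Icc (0 : ℝ) 1, (L : ℝ≥0∞) := by
            refine lintegral_mono_ae ((ae_restrict_iff' measurableSet_Icc).2 ?_)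
            filter_upwards [hw1] with t ht htI
            exact ht (hQ.shift_mem hx hy hwQ hs0.le hs1.le htI)
        _ = L := by simp
    have h7 : |g ((1 - s) • y + s • w) - g ((1 - s) • x + s • w)| ≤ L * dist y x := by
      have h8 := h4.trans (mul_le_mul_right h6 _)
      rw [← ofReal_norm, ← ofReal_norm, ← ENNReal.ofReal_coe_nnreal,
        ← ENNReal.ofReal_mul (norm_nonneg _), ENNReal.ofReal_le_ofReal_iff (by positivity),
        norm_smul, Real.norm_eq_abs, Real.norm_of_nonneg (by linarith : 0 ≤ 1 - s)] at h8
      refine h8.trans ?_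
      rw [mul_comm, dist_eq_norm]
      gcongr
      exact mul_le_of_le_one_left (norm_nonneg _) (by linarith)
    have h9 := Convex.abs_sub_le_abs_shift_sub_add K.coe_nonneg
      (fun a _ b _ => by simpa [Real.dist_eq] using hg.dist_le_mul a b) hQ hD hx hy hwQ hs0.le hs1.le
    linarith
  have hlim : Filter.Tendsto (fun s : ℝ => L * dist y x + 2 * (K * (s * D)))
      (nhdsWithin 0 (Set.Ioi 0)) (nhds (L * dist y x)) := by
    have : Continuous fun s : ℝ => L * dist y x + 2 * (K * (s * D)) := by fun_prop
    simpa using (this.tendsto 0).mono_left nhdsWithin_le_nhds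
  refine ge_of_tendsto hlim ?_
  filter_upwards [Ioo_mem_nhdsGT (zero_lt_one' ℝ)] with s hs using hmain s hs

/-- Oscillation bound on a convex body `Q` of diameter at most `D`, interpolating between the
Lipschitz constant and the `L¹` norm of the derivative. -/
theorem LipschitzWith.abs_sub_pow_mul_measure_le {g : E → ℝ} {K : ℝ≥0} (hg : LipschitzWith K g)
    {Q : Set E} (hQ : Convex ℝ Q) (hQm : MeasurableSet Q) {D : ℝ}
    (hD : ∀ a ∈ Q, ∀ b ∈ Q, dist a b ≤ D) {L : ℝ} (hL0 : 0 ≤ L)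
    (hL : ∀ a ∈ Q, ∀ b ∈ Q, |g a - g b| ≤ L * dist a b) {x y : E} (hx : x ∈ Q) (hy : y ∈ Q)
    {n : ℕ} (hn : Module.finrank ℝ E = n + 1) :
    ENNReal.ofReal (|g y - g x| ^ (n + 1)) * μ Q ≤
      ENNReal.ofReal (2 * (4 * L) ^ n * D ^ (n + 1)) * ∫⁻ z in Q, ‖fderiv ℝ g z‖ₑ ∂μ := by
  set M := |g y - g x| with hM
  rcases (abs_nonneg (g y - g x)).eq_or_lt with h0 | hpos
  · simp [hM, ← h0]
  rw [← hM] at hpos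
  have hLD : M ≤ L * D := (hL y hy x hx).trans (by gcongr; exact hD y hy x hx)
  have hD0 : 0 ≤ D := dist_nonneg.trans (hD x hx y hy)
  have hLp : 0 < L := hL0.lt_of_ne fun h => by rw [← h, zero_mul] at hLD; linarith
  have hDp : 0 < D := hD0.lt_of_ne fun h => by rw [← h, mul_zero] at hLD; linarith
  -- With this choice the two endpoint errors sum to `M / 2`, so every shifted segment keeps an
  -- increment of at least `M / 2`.
  set s := M / (4 * (L * D)) with hs
  have hs0 : 0 < s := by positivity
  have hs1 : s < 1 := by rw [hs, div_lt_one (by positivity)]; nlinarith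
  have hsL : L * (s * D) = M / 4 := by rw [hs]; field_simp
  have h1 := hg.lintegral_shift_le μ hQ hQm hD hx hy hs0 hs1
  have h2 : ENNReal.ofReal (M / 2) * μ Q ≤
      ∫⁻ w in Q, ‖g ((1 - s) • y + s • w) - g ((1 - s) • x + s • w)‖ₑ ∂μ := by
    rw [← setLIntegral_const]
    refine setLIntegral_mono' hQm fun w hw => ?_
    rw [← ofReal_norm]
    refine ENNReal.ofReal_le_ofReal ?_
    have h3 := Convex.abs_sub_le_abs_shift_sub_add hL0 hL hQ hD hx hy hw hs0.le hs1.le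
    rw [hsL, ← hM] at h3
    rw [Real.norm_eq_abs]
    linarith
  have h4 := (mul_le_mul_right h2 _).trans h1
  rw [hn] at h4
  -- The multiplier turns `s ^ (n + 1) * (M / 2)` into `M ^ (n + 1)`; on the right, `M / s = 4 * L *
  -- D` removes `M`.
  have h5 := mul_le_mul_right h4 (ENNReal.ofReal (2 * M ^ n / s ^ (n + 1)))
  rw [← mul_assoc, ← mul_assoc, ← mul_assoc, ← ENNReal.ofReal_mul (by positivity),
    ← ENNReal.ofReal_mul (by positivity), ← ENNReal.ofReal_mul (by positivity)] at h5
  have e1 : 2 * M ^ n / s ^ (n + 1) * s ^ (n + 1) * (M / 2) = M ^ (n + 1) := by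
    field_simp
    ring
  have e2 : 2 * M ^ n / s ^ (n + 1) * (s * D) = 2 * (4 * L) ^ n * D ^ (n + 1) := by
    have hM4 : M = 4 * L * D * s := by linarith
    rw [hM4, mul_pow (4 * L * D), mul_pow (4 * L)]
    field_simp
    ring
  rwa [e1, e2] at h5

end Oscillation

/-! ### Geometry of the cube and the local oscillation bound. -/

section UnitCube

theorem unitCube_eq_preimage (d : ℕ) :
    unitCube d = WithLp.ofLp ⁻¹' Set.Icc (0 : Fin d → ℝ) 1 := by
  ext x
  simp [unitCube, Set.mem_Icc, Pi.le_def, forall_and]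

theorem measurableSet_unitCube (d : ℕ) : MeasurableSet (unitCube d) := by
  rw [unitCube_eq_preimage]
  exact measurableSet_Icc.preimage (by fun_prop)

theorem volume_unitCube (d : ℕ) : volume (unitCube d) = 1 := by
  rw [unitCube_eq_preimage, (PiLp.volume_preserving_ofLp (Fin d)).measure_preimage
    measurableSet_Icc.nullMeasurableSet, Real.volume_Icc_pi]
  simp

theorem convex_unitCube (d : ℕ) : Convex ℝ (unitCube d) := by
  intro x hx y hy a b ha hb hab i
  simpa using convex_Icc (0 : ℝ) 1 (hx i) (hy i) ha hb hab

theorem dist_le_sqrt_of_mem_unitCube {d : ℕ} {x y : EuclideanSpace ℝ (Fin d)}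
    (hx : x ∈ unitCube d) (hy : y ∈ unitCube d) : dist x y ≤ √d := by
  rw [EuclideanSpace.dist_eq]
  refine Real.sqrt_le_sqrt ?_
  calc ∑ i, dist (x i) (y i) ^ 2 ≤ ∑ _i : Fin d, (1 : ℝ) := by
        refine Finset.sum_le_sum fun i _ => pow_le_one₀ dist_nonneg ?_
        rw [Real.dist_eq, abs_le]
        constructor <;> linarith [(hx i).1, (hx i).2, (hy i).1, (hy i).2]
    _ = d := by simp

instance (d : ℕ) : IsProbabilityMeasure (cubeMeasure d) :=
  ⟨by rw [cubeMeasure, Measure.restrict_apply_univ, volume_unitCube]⟩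

/-- The copy of the cube shrunk by `r` towards `x` has volume `r ^ d` and lies in both the cube and
the ball, even when `x` is on the boundary. -/
theorem ofReal_pow_le_volume_unitCube_inter_closedBall {d : ℕ} {x : EuclideanSpace ℝ (Fin d)}
    (hx : x ∈ unitCube d) {r R : ℝ} (hr0 : 0 ≤ r) (hr1 : r ≤ 1) (hrR : r * √d ≤ R) :
    ENNReal.ofReal (r ^ d) ≤ volume (unitCube d ∩ Metric.closedBall x R) := by
  have h1 := Measure.addHaar_image_homothety volume x r (unitCube d)
  rw [volume_unitCube, mul_one, finrank_euclideanSpace_fin, abs_of_nonneg (by positivity)] at h1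
  rw [← h1]
  refine measure_mono ?_
  rintro _ ⟨u, hu, rfl⟩
  constructor
  · rw [AffineMap.homothety_eq_lineMap]
    exact (convex_unitCube d).lineMap_mem hx hu ⟨hr0, hr1⟩
  · rw [Metric.mem_closedBall, dist_homothety_center, Real.norm_of_nonneg hr0]
    exact (mul_le_mul_of_nonneg_left (dist_le_sqrt_of_mem_unitCube hx hu) hr0).trans hrR

/-- The integral of the norm of the derivative over the part of the cube in a ball. -/
noncomputable def localVariation {d : ℕ} (g : EuclideanSpace ℝ (Fin d) → ℝ) (R : ℝ)
    (x : EuclideanSpace ℝ (Fin d)) : ℝ≥0∞ :=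
  ∫⁻ z in unitCube d ∩ Metric.closedBall x R, ‖fderiv ℝ g z‖ₑ

theorem LipschitzWith.enorm_sub_le_localVariation {n : ℕ}
    {g : EuclideanSpace ℝ (Fin (n + 1)) → ℝ} {K : ℝ≥0} (hg : LipschitzWith K g) {L : ℝ≥0}
    (hL : ∀ a ∈ unitCube (n + 1), ∀ b ∈ unitCube (n + 1), |g a - g b| ≤ L * dist a b)
    {R : ℝ} (hR : 0 < R) {x y : EuclideanSpace ℝ (Fin (n + 1))} (hx : x ∈ unitCube (n + 1))
    (hy : y ∈ unitCube (n + 1)) (hxy : dist y x ≤ R) :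
    ‖g y - g x‖ₑ ≤
      ENNReal.ofReal (2 * 4 ^ n * (2 * √(n + 1 : ℕ)) ^ (n + 1)) ^ (1 / ((n + 1 : ℕ) : ℝ)) *
        (L : ℝ≥0∞) ^ ((n : ℝ) / ((n + 1 : ℕ) : ℝ)) *
        localVariation g R x ^ (1 / ((n + 1 : ℕ) : ℝ)) := by
  set q : ℝ := √(n + 1 : ℕ) with hq
  have hq0 : 0 < q := by positivity
  -- The truncation at `1` covers balls larger than the cube. In both regimes the diameter is at
  -- most `2 * q * r` and the volume at least `r ^ (n + 1)`, so `r` cancels from the estimate.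
  set r : ℝ := min (R / q) 1 with hr
  have hr0 : 0 < r := by positivity
  have hrR : r * q ≤ R := by
    rw [← le_div_iff₀ hq0]; exact min_le_left _ _
  set Q := unitCube (n + 1) ∩ Metric.closedBall x R with hQdef
  have hQ : Convex ℝ Q := (convex_unitCube _).inter (convex_closedBall _ _)
  have hQm : MeasurableSet Q := (measurableSet_unitCube _).inter measurableSet_closedBall
  have hD : ∀ a ∈ Q, ∀ b ∈ Q, dist a b ≤ 2 * q * r := by
    intro a ha b hb
    rcases min_cases (R / q) 1 with ⟨h, -⟩ | ⟨h, -⟩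
    · have h1 := dist_triangle_right a b x
      have h2 := Metric.mem_closedBall.1 ha.2
      have h3 := Metric.mem_closedBall.1 hb.2
      have h4 : 2 * q * r = 2 * R := by rw [hr, h]; field_simp
      linarith
    · rw [hr, h]
      have := dist_le_sqrt_of_mem_unitCube ha.1 hb.1
      linarith
  have hmain := hg.abs_sub_pow_mul_measure_le volume hQ hQm hD L.coe_nonneg
    (fun a ha b hb => hL a ha.1 b hb.1) (x := x) (y := y) ⟨hx, by simpa using hR.le⟩ ⟨hy, hxy⟩
    (n := n) (by simp)
  have hvol := ofReal_pow_le_volume_unitCube_inter_closedBall hx hr0.le (min_le_right _ _) hrR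
  have h1 := (mul_le_mul_right hvol _).trans hmain
  have h2 : 2 * (4 * (L : ℝ)) ^ n * (2 * q * r) ^ (n + 1) =
      (r ^ (n + 1)) * ((2 * 4 ^ n * (2 * q) ^ (n + 1)) * (L : ℝ) ^ n) := by
    rw [mul_pow, mul_pow (2 * q)]; ring
  rw [h2, mul_comm, ENNReal.ofReal_mul (by positivity), mul_assoc,
    ENNReal.mul_le_mul_iff_right (by positivity) ENNReal.ofReal_ne_top,
    ENNReal.ofReal_mul (by positivity), ENNReal.ofReal_pow (abs_nonneg _),
    ENNReal.ofReal_pow L.coe_nonneg, ENNReal.ofReal_coe_nnreal, ← Real.norm_eq_abs,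
    ofReal_norm] at h1
  have h3 := ENNReal.rpow_le_rpow h1 (z := 1 / ((n + 1 : ℕ) : ℝ)) (by positivity)
  rw [ENNReal.mul_rpow_of_nonneg _ _ (by positivity), ENNReal.mul_rpow_of_nonneg _ _ (by positivity),
    ← ENNReal.rpow_natCast, ← ENNReal.rpow_natCast, ← ENNReal.rpow_mul, ← ENNReal.rpow_mul,
    mul_one_div_cancel (by positivity), ENNReal.rpow_one, mul_one_div] at h3
  exact h3

end UnitCube

/-! ### Empirical measures and marginals of transport plans. -/

section TransportPlan

variable {X : Type*} [MeasurableSpace X]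

theorem isProbabilityMeasure_empiricalMeasure {N : ℕ} (hN : 1 ≤ N) (x : Fin N → X) :
    IsProbabilityMeasure (empiricalMeasure x) := by
  refine ⟨?_⟩
  simp only [empiricalMeasure, Measure.smul_apply, Measure.finsetSum_apply, measure_univ,
    Finset.sum_const, Finset.card_univ, Fintype.card_fin, smul_eq_mul, nsmul_eq_mul, mul_one]
  exact ENNReal.inv_mul_cancel (by simpa using by omega) (by simp)

theorem lintegral_empiricalMeasure {N : ℕ} (x : Fin N → X) {h : X → ℝ≥0∞} (hh : Measurable h) :
    ∫⁻ y, h y ∂empiricalMeasure x = (N : ℝ≥0∞)⁻¹ * ∑ k, h (x k) := by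
  rw [empiricalMeasure, lintegral_smul_measure, lintegral_finsetSum_measure, smul_eq_mul]
  simp_rw [lintegral_dirac' _ hh]

theorem integral_empiricalMeasure {N : ℕ} (x : Fin N → X) {h : X → ℝ} (hh : StronglyMeasurable h) :
    Integrable h (empiricalMeasure x) ∧
      ∫ y, h y ∂empiricalMeasure x = (1 / (N : ℝ)) * ∑ k, h (x k) := by
  have hi : ∀ k ∈ Finset.univ, Integrable h (Measure.dirac (x k)) := fun k _ =>
    integrable_dirac' hh enorm_lt_top
  constructor
  · rcases N.eq_zero_or_pos with rfl | hN
    · simp [empiricalMeasure]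
    · exact ((integrable_finsetSum_measure).2 hi).smul_measure (by simpa using by omega)
  · rw [empiricalMeasure, integral_smul_measure, integral_finsetSum_measure hi]
    simp_rw [integral_dirac' _ _ hh]
    simp

theorem IsTransportPlan.lintegral_snd {μ ν : Measure X} {π : Measure (X × X)}
    (hπ : IsTransportPlan μ ν π) {h : X → ℝ≥0∞} (hh : Measurable h) :
    ∫⁻ p, h p.2 ∂π = ∫⁻ y, h y ∂ν := by
  rw [← hπ.2, Measure.snd, lintegral_map hh measurable_snd]

theorem IsTransportPlan.ae_fst {μ ν : Measure X} {π : Measure (X × X)}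
    (hπ : IsTransportPlan μ ν π) {P : X → Prop} (h : ∀ᵐ y ∂μ, P y) : ∀ᵐ p ∂π, P p.1 := by
  rw [← hπ.1, Measure.fst] at h
  exact ae_of_ae_map measurable_fst.aemeasurable h

theorem IsTransportPlan.ae_snd {μ ν : Measure X} {π : Measure (X × X)}
    (hπ : IsTransportPlan μ ν π) {P : X → Prop} (h : ∀ᵐ y ∂ν, P y) : ∀ᵐ p ∂π, P p.2 := by
  rw [← hπ.2, Measure.snd] at h
  exact ae_of_ae_map measurable_snd.aemeasurable h

theorem ae_empiricalMeasure {N : ℕ} {x : Fin N → X} {S : Set X} (hS : MeasurableSet S)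
    (h : ∀ k, x k ∈ S) : ∀ᵐ y ∂empiricalMeasure x, y ∈ S := by
  rw [ae_iff, ← Set.compl_def, empiricalMeasure]
  simp [Measure.dirac_apply' _ hS.compl, h]

/-- The mass that a plan moving points by at most `R` puts on a ball is bounded by the mass
of the ball enlarged by `R`. -/
theorem IsTransportPlan.measure_closedBall_le {X : Type*} [PseudoMetricSpace X]
    [MeasurableSpace X] [OpensMeasurableSpace X] {μ ν : Measure X} {π : Measure (X × X)}
    (hπ : IsTransportPlan μ ν π) {R : ℝ} (hR : ∀ᵐ p ∂π, dist p.1 p.2 ≤ R) (z : X) (ρ : ℝ) :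
    ν (Metric.closedBall z ρ) ≤ μ (Metric.closedBall z (ρ + R)) := by
  rw [← hπ.1, ← hπ.2, Measure.fst_apply measurableSet_closedBall,
    Measure.snd_apply measurableSet_closedBall]
  refine measure_mono_ae ?_
  filter_upwards [hR] with p hp h
  have h1 : dist p.2 z ≤ ρ := h
  have h2 := dist_triangle p.1 p.2 z
  show dist p.1 z ≤ ρ + R
  linarith

end TransportPlan

/-! ### The quadrature error for a single plan. -/

section PlanEstimate

theorem measurable_localVariation {d : ℕ} (g : EuclideanSpace ℝ (Fin d) → ℝ) (R : ℝ) :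
    Measurable (localVariation g R) ∧ ∀ x, localVariation g R x =
      ∫⁻ z, {q : _ × _ | dist q.2 q.1 ≤ R}.indicator (fun q => ‖fderiv ℝ g q.2‖ₑ) (x, z)
        ∂cubeMeasure d := by
  have hS : MeasurableSet {q : EuclideanSpace ℝ (Fin d) × EuclideanSpace ℝ (Fin d) |
      dist q.2 q.1 ≤ R} :=
    measurableSet_le (by fun_prop) measurable_const
  have heq : ∀ x, localVariation g R x =
      ∫⁻ z, {q : _ × _ | dist q.2 q.1 ≤ R}.indicator (fun q => ‖fderiv ℝ g q.2‖ₑ) (x, z)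
        ∂cubeMeasure d := by
    intro x
    rw [localVariation, Set.inter_comm, ← Measure.restrict_restrict measurableSet_closedBall,
      ← lintegral_indicator measurableSet_closedBall]
    rfl
  refine ⟨?_, heq⟩
  have : localVariation g R = fun x => _ := funext heq
  rw [this]
  exact Measurable.lintegral_prod_right
    (((measurable_fderiv ℝ g).enorm.comp measurable_snd).indicator hS)

/-- Fubini: `z` contributes to the local variation at `x` exactly when `x` lies in the ball of
radius `R` about `z`. -/
theorem lintegral_localVariation_le {d : ℕ} {ν : Measure (EuclideanSpace ℝ (Fin d))} [SFinite ν]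
    {g : EuclideanSpace ℝ (Fin d) → ℝ} {R : ℝ} {B : ℝ≥0∞}
    (hB : ∀ z, ν (Metric.closedBall z R) ≤ B) :
    ∫⁻ x, localVariation g R x ∂ν ≤ B * ∫⁻ z, ‖fderiv ℝ g z‖ₑ ∂cubeMeasure d := by
  have hS : MeasurableSet {q : EuclideanSpace ℝ (Fin d) × EuclideanSpace ℝ (Fin d) |
      dist q.2 q.1 ≤ R} :=
    measurableSet_le (by fun_prop) measurable_const
  have hm : Measurable ({q : EuclideanSpace ℝ (Fin d) × EuclideanSpace ℝ (Fin d) |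
      dist q.2 q.1 ≤ R}.indicator (fun q => ‖fderiv ℝ g q.2‖ₑ)) :=
    ((measurable_fderiv ℝ g).enorm.comp measurable_snd).indicator hS
  simp_rw [(measurable_localVariation g R).2]
  rw [lintegral_lintegral_swap (f := fun x z => {q : EuclideanSpace ℝ (Fin d) ×
      EuclideanSpace ℝ (Fin d) | dist q.2 q.1 ≤ R}.indicator (fun q => ‖fderiv ℝ g q.2‖ₑ) (x, z))
      hm.aemeasurable,
    ← lintegral_const_mul _ (measurable_fderiv ℝ g).enorm]
  refine lintegral_mono fun z => ?_
  have h1 : ∀ x, {q : EuclideanSpace ℝ (Fin d) × EuclideanSpace ℝ (Fin d) |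
      dist q.2 q.1 ≤ R}.indicator (fun q => ‖fderiv ℝ g q.2‖ₑ) (x, z) =
      (Metric.closedBall z R).indicator (fun _ => ‖fderiv ℝ g z‖ₑ) x := by
    intro x
    classical simp only [Set.indicator_apply, Set.mem_ofPred_eq, Metric.mem_closedBall,
      dist_comm x z]
  simp_rw [h1]
  rw [lintegral_indicator measurableSet_closedBall, setLIntegral_const, mul_comm]
  gcongr
  exact hB z

/-- Jensen for the concave power `1 / d`, obtained from convexity of the power `d`. -/
theorem ENNReal.inv_mul_sum_rpow_le {N : ℕ} (hN : 1 ≤ N) {d : ℕ} (hd : 1 ≤ d) (z : Fin N → ℝ≥0∞) :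
    (N : ℝ≥0∞)⁻¹ * ∑ k, z k ^ (1 / (d : ℝ)) ≤ ((N : ℝ≥0∞)⁻¹ * ∑ k, z k) ^ (1 / (d : ℝ)) := by
  have hd0 : (0 : ℝ) < d := by exact_mod_cast hd
  have h := ENNReal.rpow_arith_mean_le_arith_mean_rpow Finset.univ (fun _ : Fin N => (N : ℝ≥0∞)⁻¹)
    (fun k => z k ^ (1 / (d : ℝ)))
    (by simpa using ENNReal.mul_inv_cancel (by simpa using by omega) (by simp))
    (p := d) (by exact_mod_cast hd)
  simp_rw [← ENNReal.rpow_mul, one_div_mul_cancel hd0.ne', ENNReal.rpow_one, ← Finset.mul_sum] at h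
  have h2 := ENNReal.rpow_le_rpow h (z := 1 / (d : ℝ)) (by positivity)
  rwa [← ENNReal.rpow_mul, mul_one_div_cancel hd0.ne', ENNReal.rpow_one] at h2

/-- The constant in the quadrature estimate. -/
noncomputable def quadratureConstant (n : ℕ) : ℝ≥0∞ :=
  ENNReal.ofReal (2 * 4 ^ n * (2 * √(n + 1 : ℕ)) ^ (n + 1)) ^ (1 / ((n + 1 : ℕ) : ℝ)) * 2 *
    (volume (Metric.ball (0 : EuclideanSpace ℝ (Fin (n + 1))) 1) ^ (1 / ((n + 1 : ℕ) : ℝ))) ^ 2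

theorem quadratureConstant_ne_top (n : ℕ) : quadratureConstant n ≠ ⊤ := by
  have h0 : (0 : ℝ) ≤ 1 / ((n + 1 : ℕ) : ℝ) := by positivity
  exact ENNReal.mul_ne_top (ENNReal.mul_ne_top
    (ENNReal.rpow_ne_top_of_nonneg h0 ENNReal.ofReal_ne_top) (by simp))
    (ENNReal.pow_ne_top (ENNReal.rpow_ne_top_of_nonneg h0 measure_ball_lt_top.ne))

/-- An atom of mass at least `1 / N` is fed from within distance `R`, so a ball of radius `R` has
volume at least `1 / N`. -/
theorem IsTransportPlan.one_le_radius {n N : ℕ} (hN : 1 ≤ N)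
    {x : Fin N → EuclideanSpace ℝ (Fin (n + 1))}
    {π : Measure (EuclideanSpace ℝ (Fin (n + 1)) × EuclideanSpace ℝ (Fin (n + 1)))}
    (hπ : IsTransportPlan (cubeMeasure (n + 1)) (empiricalMeasure x) π) {R : ℝ} (hR0 : 0 ≤ R)
    (hR : ∀ᵐ p ∂π, dist p.1 p.2 ≤ R) :
    1 ≤ (N : ℝ≥0∞) ^ (1 / ((n + 1 : ℕ) : ℝ)) * (ENNReal.ofReal R *
      volume (Metric.ball (0 : EuclideanSpace ℝ (Fin (n + 1))) 1) ^ (1 / ((n + 1 : ℕ) : ℝ))) := by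
  -- Radius `0` isolates the atom.
  have h1 := hπ.measure_closedBall_le hR (x ⟨0, hN⟩) 0
  have h2 : (N : ℝ≥0∞)⁻¹ ≤ empiricalMeasure x (Metric.closedBall (x ⟨0, hN⟩) 0) := by
    rw [empiricalMeasure, Measure.smul_apply, Measure.finsetSum_apply, smul_eq_mul]
    refine le_mul_of_one_le_right' ?_
    refine le_trans ?_ (Finset.single_le_sum (fun _ _ => zero_le) (Finset.mem_univ ⟨0, hN⟩))
    rw [Measure.dirac_apply' _ measurableSet_closedBall, Set.indicator_of_mem (by simp)]
    rfl
  have h3 : (N : ℝ≥0∞)⁻¹ ≤ ENNReal.ofReal R ^ (n + 1) *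
      volume (Metric.ball (0 : EuclideanSpace ℝ (Fin (n + 1))) 1) := by
    refine (h2.trans h1).trans ((Measure.restrict_apply_le _ _).trans ?_)
    rw [zero_add, Measure.addHaar_closedBall _ _ hR0, finrank_euclideanSpace_fin,
      ENNReal.ofReal_pow hR0]
  replace h3 := mul_le_mul_right h3 (N : ℝ≥0∞)
  rw [ENNReal.mul_inv_cancel (Nat.cast_ne_zero.2 (by omega)) (ENNReal.natCast_ne_top N)] at h3
  have h4 := ENNReal.rpow_le_rpow h3 (z := 1 / ((n + 1 : ℕ) : ℝ)) (by positivity)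
  rwa [ENNReal.one_rpow, ENNReal.mul_rpow_of_nonneg _ _ (by positivity),
    ENNReal.mul_rpow_of_nonneg _ _ (by positivity), ← ENNReal.rpow_natCast, ← ENNReal.rpow_mul,
    mul_one_div_cancel (by positivity), ENNReal.rpow_one] at h4

theorem IsTransportPlan.quadrature_error_le {n N : ℕ} (hN : 1 ≤ N)
    {x : Fin N → EuclideanSpace ℝ (Fin (n + 1))} (hx : ∀ k, x k ∈ unitCube (n + 1))
    {g : EuclideanSpace ℝ (Fin (n + 1)) → ℝ} {K : ℝ≥0} (hg : LipschitzWith K g) {L : ℝ≥0}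
    (hL : ∀ a ∈ unitCube (n + 1), ∀ b ∈ unitCube (n + 1), |g a - g b| ≤ L * dist a b)
    {π : Measure (EuclideanSpace ℝ (Fin (n + 1)) × EuclideanSpace ℝ (Fin (n + 1)))}
    (hπ : IsTransportPlan (cubeMeasure (n + 1)) (empiricalMeasure x) π) {R : ℝ} (hR0 : 0 ≤ R)
    (hR : ∀ᵐ p ∂π, dist p.1 p.2 ≤ R) :
    ENNReal.ofReal |(∫ y in unitCube (n + 1), g y) - (1 / (N : ℝ)) * ∑ k, g (x k)| ≤
      quadratureConstant n * (L : ℝ≥0∞) ^ ((n : ℝ) / ((n + 1 : ℕ) : ℝ)) *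
        (∫⁻ z, ‖fderiv ℝ g z‖ₑ ∂cubeMeasure (n + 1)) ^ (1 / ((n + 1 : ℕ) : ℝ)) *
        (N : ℝ≥0∞) ^ (1 / ((n + 1 : ℕ) : ℝ)) * ENNReal.ofReal R ^ 2 := by
  have := isProbabilityMeasure_empiricalMeasure hN x
  set V := volume (Metric.ball (0 : EuclideanSpace ℝ (Fin (n + 1))) 1) with hV
  set I1 := ∫⁻ z, ‖fderiv ℝ g z‖ₑ ∂cubeMeasure (n + 1) with hI1
  set C1 := ENNReal.ofReal (2 * 4 ^ n * (2 * √(n + 1 : ℕ)) ^ (n + 1)) ^ (1 / ((n + 1 : ℕ) : ℝ))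
    with hC1
  set A := (L : ℝ≥0∞) ^ ((n : ℝ) / ((n + 1 : ℕ) : ℝ)) with hA
  set e : ℝ := 1 / ((n + 1 : ℕ) : ℝ) with he
  have he0 : 0 ≤ e := by positivity
  have hone := hπ.one_le_radius hN hR0 hR
  -- `R = 0` would turn `hone` into `1 ≤ 0`.
  have hRpos : 0 < R := by
    refine hR0.lt_of_ne fun h => ?_
    simp [← h] at hone
  have hc1 : ∀ᵐ p ∂π, p.1 ∈ unitCube (n + 1) :=
    hπ.ae_fst (ae_restrict_mem (measurableSet_unitCube _))
  have hc2 : ∀ᵐ p ∂π, p.2 ∈ unitCube (n + 1) :=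
    hπ.ae_snd (ae_empiricalMeasure (measurableSet_unitCube _) hx)
  have hgm : StronglyMeasurable g := hg.continuous.stronglyMeasurable
  have hgi : Integrable g (cubeMeasure (n + 1)) := by
    refine Integrable.of_bound hgm.aestronglyMeasurable (|g 0| + L * √(n + 1 : ℕ)) ?_
    filter_upwards [ae_restrict_mem (measurableSet_unitCube (n + 1))] with z hz
    have h0 : (0 : EuclideanSpace ℝ (Fin (n + 1))) ∈ unitCube (n + 1) := fun i => by simp
    have h1 := (hL z hz 0 h0).trans
      (mul_le_mul_of_nonneg_left (dist_le_sqrt_of_mem_unitCube hz h0) L.coe_nonneg)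
    have h2 := abs_sub_abs_le_abs_sub (g z) (g 0)
    rw [Real.norm_eq_abs]
    linarith
  have hgν := integral_empiricalMeasure x hgm
  have hdiff : (∫ y in unitCube (n + 1), g y) - (1 / (N : ℝ)) * ∑ k, g (x k) =
      ∫ p, (g p.1 - g p.2) ∂π := by
    have hi1 : Integrable g (π.map Prod.fst) := by
      have := hπ.1; rw [Measure.fst] at this; rwa [this]
    have hi2 : Integrable g (π.map Prod.snd) := by
      have := hπ.2; rw [Measure.snd] at this; rw [this]; exact hgν.1
    have hs : ∫ p, (g p.1 - g p.2) ∂π = ∫ p, g p.1 ∂π - ∫ p, g p.2 ∂π :=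
      integral_sub (hi1.comp_measurable measurable_fst) (hi2.comp_measurable measurable_snd)
    rw [hs, ← hgν.2, ← integral_map (f := g) measurable_fst.aemeasurable hgm.aestronglyMeasurable,
      ← integral_map (f := g) measurable_snd.aemeasurable hgm.aestronglyMeasurable,
      ← Measure.fst, ← Measure.snd, hπ.1, hπ.2, cubeMeasure]
  have hball : ∀ z, empiricalMeasure x (Metric.closedBall z R) ≤
      ENNReal.ofReal (2 * R) ^ (n + 1) * V := by
    intro z
    refine (hπ.measure_closedBall_le hR z R).trans ((Measure.restrict_apply_le _ _).trans ?_)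
    rw [← two_mul, Measure.addHaar_closedBall _ _ (by positivity), finrank_euclideanSpace_fin,
      ENNReal.ofReal_pow (by positivity)]
  have hIm := (measurable_localVariation g R).1
  calc ENNReal.ofReal |(∫ y in unitCube (n + 1), g y) - (1 / (N : ℝ)) * ∑ k, g (x k)|
      = ‖∫ p, (g p.1 - g p.2) ∂π‖ₑ := by rw [hdiff, ← Real.norm_eq_abs, ofReal_norm]
    _ ≤ ∫⁻ p, ‖g p.1 - g p.2‖ₑ ∂π := enorm_integral_le_lintegral_enorm _
    _ ≤ ∫⁻ p, C1 * A * localVariation g R p.2 ^ e ∂π := by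
        refine lintegral_mono_ae ?_
        filter_upwards [hc1, hc2, hR] with p h1 h2 h3
        exact hg.enorm_sub_le_localVariation hL hRpos h2 h1 h3
    _ = C1 * A * ((N : ℝ≥0∞)⁻¹ * ∑ k, localVariation g R (x k) ^ e) := by
        rw [hπ.lintegral_snd (h := fun y => C1 * A * localVariation g R y ^ e) (by fun_prop),
          lintegral_const_mul _ (by fun_prop), lintegral_empiricalMeasure x (by fun_prop)]
    _ ≤ C1 * A * (∫⁻ y, localVariation g R y ∂empiricalMeasure x) ^ e := by
        rw [lintegral_empiricalMeasure x hIm]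
        gcongr
        exact ENNReal.inv_mul_sum_rpow_le hN (by omega) _
    _ ≤ C1 * A * (ENNReal.ofReal (2 * R) ^ (n + 1) * V * I1) ^ e := by
        gcongr
        exact lintegral_localVariation_le hball
    _ = C1 * A * (2 * ENNReal.ofReal R * V ^ e * I1 ^ e) * 1 := by
        rw [ENNReal.mul_rpow_of_nonneg _ _ he0, ENNReal.mul_rpow_of_nonneg _ _ he0,
          ← ENNReal.rpow_natCast, ← ENNReal.rpow_mul, he, mul_one_div_cancel (by positivity),
          ENNReal.rpow_one, ENNReal.ofReal_mul zero_le_two, mul_one]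
        simp
    -- The factor `1` is replaced by the bound `hone`; this creates `N ^ e`, the second `R` and the
    -- second `V ^ e`.
    _ ≤ C1 * A * (2 * ENNReal.ofReal R * V ^ e * I1 ^ e) *
          ((N : ℝ≥0∞) ^ e * (ENNReal.ofReal R * V ^ e)) := by gcongr
    _ = quadratureConstant n * A * I1 ^ e * (N : ℝ≥0∞) ^ e * ENNReal.ofReal R ^ 2 := by
        rw [quadratureConstant]
        ring

end PlanEstimate

/-! ### Passage from the cube to the whole space, and the infimum over plans. -/

/-- The boundary of a convex set is null, and at interior points the two functions agree on a
neighbourhood. -/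
theorem gradient_ae_eq_of_eqOn_unitCube {d : ℕ} {f g : EuclideanSpace ℝ (Fin d) → ℝ}
    (hfg : Set.EqOn f g (unitCube d)) : gradient f =ᵐ[cubeMeasure d] gradient g := by
  have h1 : ∀ᵐ z, z ∉ frontier (unitCube d) :=
    measure_eq_zero_iff_ae_notMem.1 ((convex_unitCube d).addHaar_frontier volume)
  filter_upwards [ae_restrict_of_ae h1, ae_restrict_mem (measurableSet_unitCube d)] with z hz hzQ
  have hint : z ∈ interior (unitCube d) := by
    by_contra h
    exact hz ⟨subset_closure hzQ, h⟩
  have heq : f =ᶠ[nhds z] g := by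
    filter_upwards [mem_interior_iff_mem_nhds.1 hint] with y hy using hfg hy
  rw [gradient, gradient, heq.fderiv_eq]

theorem enorm_gradient {F : Type*} [NormedAddCommGroup F] [InnerProductSpace ℝ F] [CompleteSpace F]
    (g : F → ℝ) (z : F) : ‖gradient g z‖ₑ = ‖fderiv ℝ g z‖ₑ := by
  rw [gradient, LinearIsometryEquiv.enorm_map]

theorem IsTransportPlan.ae_dist_le_sqrt {d N : ℕ} {x : Fin N → EuclideanSpace ℝ (Fin d)}
    (hx : ∀ k, x k ∈ unitCube d)
    {π : Measure (EuclideanSpace ℝ (Fin d) × EuclideanSpace ℝ (Fin d))}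
    (hπ : IsTransportPlan (cubeMeasure d) (empiricalMeasure x) π) :
    ∀ᵐ p ∂π, dist p.1 p.2 ≤ √d := by
  filter_upwards [hπ.ae_fst (ae_restrict_mem (measurableSet_unitCube d)),
    hπ.ae_snd (ae_empiricalMeasure (measurableSet_unitCube d) hx)] with p h1 h2
  exact dist_le_sqrt_of_mem_unitCube h1 h2

theorem IsTransportPlan.essSup_ne_top {d N : ℕ} {x : Fin N → EuclideanSpace ℝ (Fin d)}
    (hx : ∀ k, x k ∈ unitCube d)
    {π : Measure (EuclideanSpace ℝ (Fin d) × EuclideanSpace ℝ (Fin d))}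
    (hπ : IsTransportPlan (cubeMeasure d) (empiricalMeasure x) π) :
    essSup (fun p => edist p.1 p.2) π ≠ ⊤ := by
  refine ne_top_of_le_ne_top (ENNReal.ofReal_ne_top (r := √d)) (essSup_le_of_ae_le _ ?_)
  filter_upwards [hπ.ae_dist_le_sqrt hx] with p hp
  rw [edist_dist]
  exact ENNReal.ofReal_le_ofReal hp

theorem isTransportPlan_prod {X : Type*} [MeasurableSpace X] (μ ν : Measure X)
    [IsProbabilityMeasure μ] [IsProbabilityMeasure ν] : IsTransportPlan μ ν (μ.prod ν) :=
  ⟨Measure.fst_prod, Measure.snd_prod⟩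

/-- No minimiser is needed: the bound holds for every `t` above the infimum and passes to the limit
by continuity of `A * t ^ 2`, where `A` is finite. -/
theorem ENNReal.le_const_mul_sq_iInf {ι : Sort*} {r : ι → ℝ≥0∞} {a A : ℝ≥0∞} (hA : A ≠ ⊤)
    (hr : ⨅ i, r i ≠ ⊤) (h : ∀ i, r i ≠ ⊤ → a ≤ A * r i ^ 2) : a ≤ A * (⨅ i, r i) ^ 2 := by
  have hlim : Filter.Tendsto (fun t : ℝ≥0∞ => A * t ^ 2) (nhdsWithin (⨅ i, r i) (Set.Ioi (⨅ i, r i)))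
      (nhds (A * (⨅ i, r i) ^ 2)) :=
    ENNReal.Tendsto.const_mul (((ENNReal.continuous_pow 2).tendsto _).mono_left
      nhdsWithin_le_nhds) (Or.inr hA)
  have : (nhdsWithin (⨅ i, r i) (Set.Ioi (⨅ i, r i))).NeBot :=
    nhdsGT_neBot_of_exists_gt ⟨⊤, lt_top_iff_ne_top.2 hr⟩
  refine ge_of_tendsto hlim ?_
  filter_upwards [self_mem_nhdsWithin] with t ht
  obtain ⟨i, hi⟩ := iInf_lt_iff.1 (Set.mem_Ioi.1 ht)
  exact (h i hi.ne_top).trans (by gcongr)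

theorem mainTheorem1 (d : ℕ) (hd : 1 ≤ d) :
    ∃ C : ℝ, 0 < C ∧
      ∀ (N : ℕ), 1 ≤ N →
      ∀ x : Fin N → EuclideanSpace ℝ (Fin d), (∀ k, x k ∈ unitCube d) →
      ∀ (f : EuclideanSpace ℝ (Fin d) → ℝ) (K : ℝ≥0), LipschitzOnWith K f (unitCube d) →
        ENNReal.ofReal |(∫ y in unitCube d, f y) - (1 / (N : ℝ)) * ∑ k, f (x k)| ≤
          ENNReal.ofReal C
            * eLpNorm (gradient f) ∞ (cubeMeasure d) ^ (((d : ℝ) - 1) / (d : ℝ))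
            * eLpNorm (gradient f) 1 (cubeMeasure d) ^ (1 / (d : ℝ))
            * (N : ℝ≥0∞) ^ (1 / (d : ℝ))
            * wassersteinInfty (cubeMeasure d) (empiricalMeasure x) ^ 2 := by
  obtain ⟨n, rfl⟩ := Nat.exists_eq_add_of_le' hd
  refine ⟨(quadratureConstant n).toReal + 1, by positivity, fun N hN x hx f K hf => ?_⟩
  -- A globally Lipschitz extension makes the derivative available almost everywhere on the whole
  -- space.
  obtain ⟨g, hg, hfg⟩ := hf.extend_real
  have hgrad := gradient_ae_eq_of_eqOn_unitCube hfg
  have hint : ∫ y in unitCube (n + 1), f y = ∫ y in unitCube (n + 1), g y :=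
    setIntegral_congr_fun (measurableSet_unitCube _) hfg
  have hsum : ∑ k, f (x k) = ∑ k, g (x k) := Finset.sum_congr rfl fun k _ => hfg (hx k)
  -- For `n = 0` the exponent is `0`, and the power equals `1` even at base `0`.
  have hexp : (((n + 1 : ℕ) : ℝ) - 1) / ((n + 1 : ℕ) : ℝ) = (n : ℝ) / ((n + 1 : ℕ) : ℝ) := by
    push_cast; ring
  rw [hint, hsum, hexp, eLpNorm_congr_ae hgrad, eLpNorm_congr_ae hgrad,
    eLpNorm_one_eq_lintegral_enorm]
  simp_rw [enorm_gradient]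
  have hbound : ∀ z, ‖fderiv ℝ g z‖ₑ ≤ K := fun z => by
    rw [enorm_le_coe]
    exact norm_fderiv_le_of_lipschitz ℝ hg
  have hLtop : eLpNorm (gradient g) ∞ (cubeMeasure (n + 1)) ≠ ⊤ := by
    rw [eLpNorm_exponent_top]
    refine ne_top_of_le_ne_top (ENNReal.coe_ne_top (r := K)) (essSup_le_of_ae_le _ ?_)
    exact Filter.Eventually.of_forall fun z => (enorm_gradient g z).trans_le (hbound z)
  lift eLpNorm (gradient g) ∞ (cubeMeasure (n + 1)) to ℝ≥0 using hLtop with L hL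
  have hLae : ∀ᵐ z ∂volume.restrict (unitCube (n + 1)), ‖fderiv ℝ g z‖ₑ ≤ L := by
    have h := ENNReal.ae_le_essSup (μ := cubeMeasure (n + 1)) (fun z => ‖gradient g z‖ₑ)
    filter_upwards [h] with z hz
    rw [hL, eLpNorm_exponent_top, ← enorm_gradient]
    exact hz
  -- The constant must be the essential supremum `L` over the cube, not the constant `K` of the
  -- extension.
  have hLip : ∀ a ∈ unitCube (n + 1), ∀ b ∈ unitCube (n + 1), |g a - g b| ≤ L * dist a b :=
    fun a ha b hb => hg.abs_sub_le_of_ae_fderiv_le volume (convex_unitCube _)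
      (measurableSet_unitCube _) (by simp [volume_unitCube])
      (fun a ha b hb => dist_le_sqrt_of_mem_unitCube ha hb) hLae hb ha
  have hL1 : ∫⁻ z, ‖fderiv ℝ g z‖ₑ ∂cubeMeasure (n + 1) ≠ ⊤ := by
    refine ne_top_of_le_ne_top (ENNReal.coe_ne_top (r := K)) ?_
    exact (lintegral_mono hbound).trans (by simp)
  have hC : quadratureConstant n ≤ ENNReal.ofReal ((quadratureConstant n).toReal + 1) := by
    rw [ENNReal.le_ofReal_iff_toReal_le (quadratureConstant_ne_top n) (by positivity)]
    linarith
  have := isProbabilityMeasure_empiricalMeasure hN x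
  rw [wassersteinInfty, iInf_subtype']
  refine ENNReal.le_const_mul_sq_iInf ?_ ?_ ?_
  · have he : 0 ≤ 1 / ((n + 1 : ℕ) : ℝ) := by positivity
    refine ENNReal.mul_ne_top (ENNReal.mul_ne_top (ENNReal.mul_ne_top ENNReal.ofReal_ne_top ?_) ?_) ?_
    · exact ENNReal.rpow_ne_top_of_nonneg (by positivity) ENNReal.coe_ne_top
    · exact ENNReal.rpow_ne_top_of_nonneg he hL1
    · exact ENNReal.rpow_ne_top_of_nonneg he (by simp)
  · have hp := isTransportPlan_prod (cubeMeasure (n + 1)) (empiricalMeasure x)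
    rw [iInf_subtype]
    exact ne_top_of_le_ne_top (hp.essSup_ne_top hx) (iInf₂_le _ hp)
  · rintro ⟨π, hπ⟩ htop
    have hR : ∀ᵐ p ∂π, dist p.1 p.2 ≤ (essSup (fun p => edist p.1 p.2) π).toReal := by
      filter_upwards [ENNReal.ae_le_essSup (μ := π) (fun p => edist p.1 p.2)] with p hp
      rw [dist_edist]
      exact ENNReal.toReal_mono htop hp
    have h := hπ.quadrature_error_le hN hx hg hLip ENNReal.toReal_nonneg hR
    rw [ENNReal.ofReal_toReal htop] at h
    exact h.trans (by gcongr)
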